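/- Let $N \ge 1$ be an integer, $p \in [1,\infty)$ and $s \in (0,1)$. Let $\{\rho_\varepsilon\}_{\varepsilon>0}$ be a family of nonnegative measurable kernels $\rho_\varepsilon : \mathbb{R}^N \to [0,\infty)$ in the admissible class $\mathcal{A}_{s,p}$, that is, $$\lim_{\varepsilon \to 0} \int_{\mathbb{R}^N} \min(1, |z|^{sp})\, \rho_\varepsilon(z)\, dz = 1 .$$ For a measurable function $u : \mathbb{R}^N \to \mathbb{R}$ put $$\mathcal{F}_\varepsilon(u) = \int_{\mathbb{R}^N \times \mathbb{R}^N} \rho_\varepsilon(y-x)\, |u(x)-u(y)|^p \, dx\, dy \in [0,\infty],$$ and let $W^{s,p}(\mathbb{R}^N)$ be the space of all $u \in L^p(\mathbb{R}^N)$ with $\int_{\mathbb{R}^N \times \mathbb{R}^N} \frac{|u(x)-u(y)|^p}{|x-y|^{N+sp}}\, dx\, dy < \infty$. Then the following three statements are equivalent. 1. (Uniform moment conditions) For every fixed $R > 0$, $$\lim_{\varepsilon \to 0} \int_{|z|>R} \rho_\varepsilon(z)\, dz = 1 \quad\text{and}\quad \lim_{\varepsilon \to 0} \int_{|z|<R}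 |z|^{sp} \rho_\varepsilon(z)\, dz = 0 .$$ 2. (Iterated-limits conditions) The iterated limits, first $\varepsilon \to 0$ and then $R \to \infty$, exist (the inner limit for all sufficiently large $R$) and satisfy $$\lim_{R \to \infty} \lim_{\varepsilon \to 0} \int_{|z|>R} \rho_\varepsilon(z)\, dz = 1 \quad\text{and}\quad \lim_{R \to \infty} \lim_{\varepsilon \to 0} \int_{|z|<R} |z|^{sp} \rho_\varepsilon(z)\, dz = 0 .$$ 3. (Maz'ya--Shaposhnikova formula in $W^{s,p}(\mathbb{R}^N)$) For every $u \in W^{s,p}(\mathbb{R}^N)$ there is $\varepsilon_0 > 0$ with $\mathcal{F}_\varepsilon(u) < \infty$ for all $0 < \varepsilon \le \varepsilon_0$, and $$\lim_{\varepsilon \to 0} \mathcal{F}_\varepsilon(u) = 2\, \|u\|_{L^p(\mathbb{R}^N)}^p ;$$ moreover, for each fixed $R > 0$, $$\lim_{\varepsilon \to 0} \int_{|z|<R} \int_{\mathbb{R}^N} \rho_\varepsilon(z)\, |u(x+z)-u(x)|^p \, dx\, dz = 0 .$$ -/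

import Mathlib

open MeasureTheory Filter Topology
open scoped ENNReal NNReal

namespace MazyaShaposhnikova

variable {N : ℕ}

/-- The nonlocal energy `∬ ρ (y - x) |u x - u y| ^ p dx dy` of `u` for one kernel `ρ`,
as an extended nonnegative number. -/
noncomputable def energy (p : ℝ) (ρ : EuclideanSpace ℝ (Fin N) → ℝ≥0)
    (u : EuclideanSpace ℝ (Fin N) → ℝ) : ℝ≥0∞ :=
  ∫⁻ q : EuclideanSpace ℝ (Fin N) × EuclideanSpace ℝ (Fin N),
    (ρ (q.2 - q.1) : ℝ≥0∞) * ‖u q.1 - u q.2‖ₑ ^ p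

/-- The domain of the energy: the functions in `L^p` of finite energy. -/
def energyDomain (p : ℝ) (ρ : EuclideanSpace ℝ (Fin N) → ℝ≥0) :
    Set (EuclideanSpace ℝ (Fin N) → ℝ) :=
  {u | MemLp u (ENNReal.ofReal p) volume ∧ energy p ρ u < ∞}

/-- The `p`-th power of the Gagliardo seminorm,
`∬ |u x - u y| ^ p / |x - y| ^ (N + s p) dx dy`. -/
noncomputable def gagliardo (s p : ℝ) (u : EuclideanSpace ℝ (Fin N) → ℝ) : ℝ≥0∞ :=
  ∫⁻ q : EuclideanSpace ℝ (Fin N) × EuclideanSpace ℝ (Fin N),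
    ‖u q.1 - u q.2‖ₑ ^ p / ‖q.1 - q.2‖ₑ ^ ((N : ℝ) + s * p)

/-- Membership in the fractional Sobolev space `W^{s,p}(ℝ^N)`. -/
def MemFracSobolev (s p : ℝ) (u : EuclideanSpace ℝ (Fin N) → ℝ) : Prop :=
  MemLp u (ENNReal.ofReal p) volume ∧ gagliardo s p u < ∞

/-- The mass of a kernel outside the ball of radius `R`. -/
noncomputable def tailMass (ρ : EuclideanSpace ℝ (Fin N) → ℝ≥0) (R : ℝ) : ℝ≥0∞ :=
  ∫⁻ z in {z : EuclideanSpace ℝ (Fin N) | R < ‖z‖}, (ρ z : ℝ≥0∞)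

/-- The `sp`-moment of a kernel inside the ball of radius `R`. -/
noncomputable def innerMoment (s p : ℝ) (ρ : EuclideanSpace ℝ (Fin N) → ℝ≥0) (R : ℝ) : ℝ≥0∞ :=
  ∫⁻ z in {z : EuclideanSpace ℝ (Fin N) | ‖z‖ < R}, ‖z‖ₑ ^ (s * p) * (ρ z : ℝ≥0∞)

/-- The part of the energy that comes from interactions at distance less than `R`. -/
noncomputable def shortRange (p : ℝ) (ρ : EuclideanSpace ℝ (Fin N) → ℝ≥0) (R : ℝ)
    (u : EuclideanSpace ℝ (Fin N) → ℝ) : ℝ≥0∞ :=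
  ∫⁻ z in {z : EuclideanSpace ℝ (Fin N) | ‖z‖ < R},
    ∫⁻ x : EuclideanSpace ℝ (Fin N), (ρ z : ℝ≥0∞) * ‖u (x + z) - u x‖ₑ ^ p

/-- The class `𝒜_{s,p}`: families of nonnegative (Lebesgue) measurable kernels with
`∫ min (1, |z| ^ (s p)) ρ_ε dz → 1` as `ε → 0⁺`. Only the values at `ε > 0` matter. -/
structure Admissible (s p : ℝ) (ρ : ℝ → EuclideanSpace ℝ (Fin N) → ℝ≥0) : Prop where
  aemeasurable : ∀ ε > 0, AEMeasurable (ρ ε) volume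
  normalized : Tendsto
    (fun ε => ∫⁻ z : EuclideanSpace ℝ (Fin N), min 1 (‖z‖ₑ ^ (s * p)) * (ρ ε z : ℝ≥0∞))
    (𝓝[>] 0) (𝓝 1)

/-- Mass escape and short-range attenuation at every fixed radius. -/
def UniformMomentConditions (s p : ℝ) (ρ : ℝ → EuclideanSpace ℝ (Fin N) → ℝ≥0) : Prop :=
  ∀ R : ℝ, 0 < R →
    Tendsto (fun ε => tailMass (ρ ε) R) (𝓝[>] 0) (𝓝 1) ∧
    Tendsto (fun ε => innerMoment s p (ρ ε) R) (𝓝[>] 0) (𝓝 0)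

/-- `lim_{R → ∞} lim_{ε → 0⁺} f ε R = l`: the inner limit exists for all large `R`,
and tends to `l`. -/
def HasIteratedLimit (f : ℝ → ℝ → ℝ≥0∞) (l : ℝ≥0∞) : Prop :=
  ∃ g : ℝ → ℝ≥0∞,
    (∀ᶠ R in atTop, Tendsto (fun ε => f ε R) (𝓝[>] 0) (𝓝 (g R))) ∧ Tendsto g atTop (𝓝 l)

/-- Mass escape and short-range attenuation as iterated limits. -/
def IteratedLimitConditions (s p : ℝ) (ρ : ℝ → EuclideanSpace ℝ (Fin N) → ℝ≥0) : Prop :=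
  HasIteratedLimit (fun ε R => tailMass (ρ ε) R) 1 ∧
  HasIteratedLimit (fun ε R => innerMoment s p (ρ ε) R) 0

/-- The Maz'ya–Shaposhnikova formula on `W^{s,p}(ℝ^N)`, with finite energies for all small `ε`
and vanishing short-range part. -/
def FormulaOnFracSobolev (s p : ℝ) (ρ : ℝ → EuclideanSpace ℝ (Fin N) → ℝ≥0) : Prop :=
  ∀ u : EuclideanSpace ℝ (Fin N) → ℝ, MemFracSobolev s p u →
    (∃ ε₀ > 0, ∀ ε, 0 < ε → ε ≤ ε₀ → u ∈ energyDomain p (ρ ε)) ∧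
    Tendsto (fun ε => energy p (ρ ε) u) (𝓝[>] 0)
      (𝓝 (2 * eLpNorm u (ENNReal.ofReal p) volume ^ p)) ∧
    ∀ R : ℝ, 0 < R → Tendsto (fun ε => shortRange p (ρ ε) R u) (𝓝[>] 0) (𝓝 0)

end MazyaShaposhnikova

/-!
# The Maz'ya–Shaposhnikova formula and escape of mass

Write `φ z = ∫ |u (x + z) - u x| ^ p dx` (`translationEnergy`). The shear `(x, y) ↦ (x, y - x)`
turns each double integral of the theorem into a weighted integral of `φ`
(`lintegral_displacement`): the energy is `∫ ρ φ`, and the `p`-th power of the Gagliardo seminorm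
is `∫ φ / |z| ^ (N + s p)`. Two facts about `φ` carry the passage from the moment conditions to the formula.

* Near the origin, finiteness of the Gagliardo seminorm upgrades to the pointwise bound
  `φ z ≤ C |z| ^ (s p)` (`translationEnergy_le_mul_enorm_rpow`), so the short-range part of the
  energy is controlled by the inner moment of the kernel.
* At infinity `φ` tends to `2 ‖u‖ ^ p` (`tendsto_translationEnergy_cobounded`), so the long-range
  part of the energy is the tail mass times nearly `2 ‖u‖ ^ p`.

For the converse it does not suffice to use only the vanishing of the short-range parts: they
vanish in the limit also when `ρ_ε z = ε |z| ^ (-N - s p + ε)` on the unit ball, whose inner moment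
tends to a positive constant. What helps is the value of the limit together with
the normalization of the kernels. A hat function `u` of radius `R / 2` lies in `W^{s,p}` and has
`φ = 2 ‖u‖ ^ p` exactly at distance at least `R`, so the formula gives tail mass tending to `1`
(`FormulaOnFracSobolev.tendsto_closedTailMass`), and the normalization leaves nothing for the
inner moment (`tendsto_innerMoment_of_closedTailMass`).

The iterated limits imply the uniform conditions because the inner moment increases with the
radius, and its vanishing forces the tail mass to tend to `1`, again by the normalization
(`tendsto_tailMass_of_innerMoment`).
-/

namespace MazyaShaposhnikova

open Metric Module Bornology

/-! ### Translation energies -/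

section Translations

variable {E : Type*} [MeasureSpace E]

lemma eLpNorm_ofReal_rpow {p : ℝ} (hp : 1 ≤ p) (u : E → ℝ) :
    eLpNorm u (ENNReal.ofReal p) volume ^ p = ∫⁻ x, ‖u x‖ₑ ^ p := by
  have hp0 : 0 < p := by linarith
  rw [eLpNorm_eq_lintegral_rpow_enorm_toReal (by simpa using hp0) ENNReal.ofReal_ne_top,
    ENNReal.toReal_ofReal hp0.le, one_div, ENNReal.rpow_inv_rpow hp0.ne']

variable [NormedAddCommGroup E]

/-- The `p`-th power of the `L^p` modulus of continuity at the shift `z`,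
`∫ |u (x + z) - u x| ^ p dx`. -/
noncomputable def translationEnergy (p : ℝ) (u : E → ℝ) (z : E) : ℝ≥0∞ :=
  ∫⁻ x : E, ‖u (x + z) - u x‖ₑ ^ p

lemma translationEnergy_eq_eLpNorm {p : ℝ} (hp : 1 ≤ p) (u : E → ℝ) (z : E) :
    translationEnergy p u z
      = eLpNorm (fun x => u (x + z) - u x) (ENNReal.ofReal p) volume ^ p :=
  (eLpNorm_ofReal_rpow hp _).symm

variable [BorelSpace E] [(volume : Measure E).IsAddHaarMeasure]

lemma aestronglyMeasurable_comp_add_right {u : E → ℝ} (hu : AEStronglyMeasurable u volume)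
    (z : E) : AEStronglyMeasurable (fun x => u (x + z)) volume :=
  hu.comp_measurePreserving (measurePreserving_add_right volume z)

lemma eLpNorm_comp_add_right {u : E → ℝ} (hu : AEStronglyMeasurable u volume) (q : ℝ≥0∞)
    (z : E) : eLpNorm (fun x => u (x + z)) q volume = eLpNorm u q volume :=
  eLpNorm_comp_measurePreserving hu (measurePreserving_add_right volume z)

lemma translationEnergy_add_le {p : ℝ} (hp : 1 ≤ p) {u : E → ℝ}
    (hu : AEStronglyMeasurable u volume) (v w : E) :
    translationEnergy p u (v + w)
      ≤ 2 ^ (p - 1) * (translationEnergy p u v + translationEnergy p u w) := by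
  have hshift : translationEnergy p u v = ∫⁻ x, ‖u (x + w + v) - u (x + w)‖ₑ ^ p :=
    (lintegral_add_right_eq_self (fun x => ‖u (x + v) - u x‖ₑ ^ p) w).symm
  have hm : AEMeasurable (fun x => ‖u (x + w) - u x‖ₑ ^ p) volume :=
    ((aestronglyMeasurable_comp_add_right hu w).sub hu).enorm.pow_const p
  have hc : (2 : ℝ≥0∞) ^ (p - 1) ≠ ∞ :=
    ENNReal.rpow_ne_top_of_nonneg (by linarith) (by simp)
  rw [hshift, translationEnergy, translationEnergy, ← lintegral_add_right' _ hm,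
    ← lintegral_const_mul' _ _ hc]
  refine lintegral_mono fun x => ?_
  refine le_trans ?_ (ENNReal.rpow_add_le_mul_rpow_add_rpow _ _ hp)
  refine ENNReal.rpow_le_rpow ?_ (by linarith)
  calc ‖u (x + (v + w)) - u x‖ₑ
      = ‖(u (x + w + v) - u (x + w)) + (u (x + w) - u x)‖ₑ := by
        rw [add_comm v w, ← add_assoc, sub_add_sub_cancel]
    _ ≤ _ := enorm_add_le _ _

/-- If `u` vanishes off a ball, then translating it by at least the diameter gives a function
with support disjoint from that of `u`. -/
lemma translationEnergy_eq_of_disjoint {p r : ℝ} (hp : 1 ≤ p) {u : E → ℝ}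
    (hu : AEStronglyMeasurable u volume) (hsupp : ∀ x, r ≤ ‖x‖ → u x = 0) {z : E}
    (hz : 2 * r ≤ ‖z‖) :
    translationEnergy p u z = 2 * eLpNorm u (ENNReal.ofReal p) volume ^ p := by
  have hp0 : 0 < p := by linarith
  have hshift : ∫⁻ x, ‖u (x + z)‖ₑ ^ p = ∫⁻ x, ‖u x‖ₑ ^ p :=
    lintegral_add_right_eq_self (fun x => ‖u x‖ₑ ^ p) z
  rw [eLpNorm_ofReal_rpow hp, two_mul]
  nth_rewrite 1 [← hshift]
  rw [← lintegral_add_right' _ (hu.enorm.pow_const p)]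
  refine lintegral_congr fun x => ?_
  by_cases hx : r ≤ ‖x‖
  · simp [hsupp x hx, ENNReal.zero_rpow_of_pos hp0]
  · have : r ≤ ‖x + z‖ := by
      have := norm_sub_le (x + z) x
      rw [add_sub_cancel_left] at this
      push Not at hx
      linarith
    simp [hsupp _ this, ENNReal.zero_rpow_of_pos hp0]

variable [NormedSpace ℝ E] [FiniteDimensional ℝ E]

lemma aemeasurable_shift_sub_rpow {p : ℝ} {u : E → ℝ} (hu : AEStronglyMeasurable u volume) :
    AEMeasurable (fun q : E × E => ‖u (q.1 + q.2) - u q.1‖ₑ ^ p) (volume.prod volume) := by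
  have h1 : AEStronglyMeasurable (fun q : E × E => u (q.1 + q.2)) (volume.prod volume) :=
    hu.comp_quasiMeasurePreserving (quasiMeasurePreserving_add volume volume)
  have h2 : AEStronglyMeasurable (fun q : E × E => u q.1) (volume.prod volume) := hu.comp_fst
  exact (h1.sub h2).enorm.pow_const p

lemma aemeasurable_translationEnergy {p : ℝ} {u : E → ℝ}
    (hu : AEStronglyMeasurable u volume) : AEMeasurable (translationEnergy p u) volume :=
  (aemeasurable_shift_sub_rpow hu).lintegral_prod_left

/-- Interactions weighted by a function of the displacement reduce, after the shear
`(x, y) ↦ (x, y - x)`, to a single integral over displacements. -/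
lemma lintegral_displacement {p : ℝ} {u : E → ℝ} (hu : AEStronglyMeasurable u volume)
    {w : E → ℝ≥0∞} (hw : AEMeasurable w volume) :
    ∫⁻ q : E × E, w (q.2 - q.1) * ‖u q.1 - u q.2‖ₑ ^ p ∂(volume.prod volume)
      = ∫⁻ z, w z * translationEnergy p u z := by
  have hshear : MeasurePreserving (MeasurableEquiv.shearAddRight E)
      ((volume : Measure E).prod volume) (volume.prod volume) :=
    measurePreserving_prod_add volume volume
  rw [← hshear.lintegral_comp_emb (MeasurableEquiv.measurableEmbedding _)]
  have hmeas := aemeasurable_shift_sub_rpow (p := p) hu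
  have hfun : (fun q : E × E => w ((MeasurableEquiv.shearAddRight E q).2
        - (MeasurableEquiv.shearAddRight E q).1)
        * ‖u (MeasurableEquiv.shearAddRight E q).1
          - u (MeasurableEquiv.shearAddRight E q).2‖ₑ ^ p)
      = fun q : E × E => w q.2 * ‖u (q.1 + q.2) - u q.1‖ₑ ^ p := by
    funext q
    have : MeasurableEquiv.shearAddRight E q = (q.1, q.1 + q.2) := rfl
    rw [this, enorm_sub_rev]
    simp
  rw [hfun, lintegral_prod_symm
    (fun q : E × E => w q.2 * ‖u (q.1 + q.2) - u q.1‖ₑ ^ p) (hw.comp_snd.mul hmeas)]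
  refine lintegral_congr_ae ?_
  filter_upwards with z
  exact lintegral_const_mul'' _
    (((aestronglyMeasurable_comp_add_right hu z).sub hu).enorm.pow_const p)

/-- If the translation energy is integrable against `|z| ^ (-(d + a))`, where `d` is the dimension,
then it is at most a constant times `|z| ^ a`. To bound it at `z`, split the shift as
`z = w + (z - w)` and average over `w` in the ball of radius `|z| / 2` centred at `z / 2`: this
ball is symmetric under `w ↦ z - w` and lies in the ball of radius `|z|` about the origin. -/
lemma translationEnergy_le_mul_enorm_rpow [Nontrivial E] {p a : ℝ} (hp : 1 ≤ p) (ha : 0 < a)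
    {u : E → ℝ} (hu : AEStronglyMeasurable u volume)
    (hfin : ∫⁻ z : E, (‖z‖ₑ ^ ((finrank ℝ E : ℝ) + a))⁻¹ * translationEnergy p u z ≠ ∞) :
    ∃ C : ℝ≥0∞, C ≠ ∞ ∧ ∀ z, translationEnergy p u z ≤ C * ‖z‖ₑ ^ a := by
  set I := ∫⁻ z : E, (‖z‖ₑ ^ ((finrank ℝ E : ℝ) + a))⁻¹ * translationEnergy p u z with hI
  set d := finrank ℝ E with hd
  have hV0 : volume (ball (0 : E) 1) ≠ 0 := (measure_ball_pos _ _ one_pos).ne'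
  have hVt : volume (ball (0 : E) 1) ≠ ∞ := measure_ball_lt_top.ne
  have h2d0 : (2 : ℝ≥0∞) ^ d ≠ 0 := by simp
  have h2dt : (2 : ℝ≥0∞) ^ d ≠ ∞ := by simp
  have hpc : (2 : ℝ≥0∞) ^ (p - 1) ≠ ∞ := ENNReal.rpow_ne_top_of_nonneg (by linarith) (by simp)
  refine ⟨2 ^ (p - 1) * 2 * I * (2 ^ d) * (volume (ball (0 : E) 1))⁻¹, by finiteness, ?_⟩
  intro z
  rcases eq_or_ne z 0 with rfl | hz
  · simp [translationEnergy, ENNReal.zero_rpow_of_pos (by linarith : 0 < p)]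
  have hz0 : ‖z‖ₑ ≠ 0 := by simpa using hz
  have hzt : ‖z‖ₑ ≠ ∞ := by simp
  set B := ball ((2 : ℝ)⁻¹ • z) (‖z‖ / 2) with hB
  have hmB : MeasurableSet B := measurableSet_ball
  have hvol : volume B * 2 ^ d = ‖z‖ₑ ^ (d : ℝ) * volume (ball (0 : E) 1) := by
    rw [hB, Measure.addHaar_ball _ _ (by positivity), div_pow,
      ENNReal.ofReal_div_of_pos (by positivity), ENNReal.ofReal_pow (by positivity),
      ENNReal.ofReal_pow (by positivity), ofReal_norm, ENNReal.rpow_natCast]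
    simp only [ENNReal.ofReal_ofNat]
    rw [mul_right_comm, ENNReal.div_mul_cancel h2d0 h2dt]
  -- the reflection `w ↦ z - w` preserves the ball
  have hrefl : ∫⁻ w in B, translationEnergy p u (z - w)
      = ∫⁻ w in B, translationEnergy p u w := by
    have hmp : MeasurePreserving (fun w : E => z - w) volume volume :=
      Measure.measurePreserving_sub_left volume z
    have := hmp.setLIntegral_comp_preimage_emb
      (MeasurableEquiv.subLeft z).measurableEmbedding (translationEnergy p u) B
    rw [← this]
    congr 2
    ext w
    simp only [hB, mem_ball, Set.mem_preimage, dist_eq_norm]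
    rw [← norm_neg]
    congr! 2
    have : z = (2 : ℝ)⁻¹ • z + (2 : ℝ)⁻¹ • z := by
      rw [← add_smul]; norm_num
    nth_rewrite 2 [this]
    abel
  have hBI : ∫⁻ w in B, translationEnergy p u w ≤ ‖z‖ₑ ^ ((d : ℝ) + a) * I := by
    rw [hI, ← lintegral_const_mul' _ _ (ENNReal.rpow_ne_top_of_nonneg (by positivity) hzt)]
    refine le_trans ?_ (setLIntegral_le_lintegral B _)
    refine lintegral_mono_ae ?_
    have hne : ∀ᵐ w ∂(volume.restrict B), w ≠ (0 : E) :=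
      ae_restrict_of_ae (Measure.ae_ne volume 0)
    filter_upwards [hne, ae_restrict_mem hmB] with w hw hwB
    have hwz : ‖w‖ₑ ≤ ‖z‖ₑ := by
      rw [enorm_le_iff_norm_le]
      have h1 : ‖w - (2 : ℝ)⁻¹ • z‖ < ‖z‖ / 2 := by simpa [hB, dist_eq_norm] using hwB
      have h2 : ‖w‖ ≤ ‖w - (2 : ℝ)⁻¹ • z‖ + ‖(2 : ℝ)⁻¹ • z‖ := by
        simpa using norm_add_le (w - (2 : ℝ)⁻¹ • z) ((2 : ℝ)⁻¹ • z)
      rw [norm_smul] at h2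
      norm_num at h2
      linarith
    have hw0 : ‖w‖ₑ ^ ((d : ℝ) + a) ≠ 0 := by
      simp only [ne_eq, ENNReal.rpow_eq_zero_iff, enorm_eq_zero, hw, false_and, enorm_ne_top,
        or_self, not_false_eq_true]
    have hwt : ‖w‖ₑ ^ ((d : ℝ) + a) ≠ ∞ :=
      ENNReal.rpow_ne_top_of_nonneg (by positivity) (by simp)
    rw [← mul_assoc]
    refine le_mul_of_one_le_left zero_le ?_
    rw [← ENNReal.mul_inv_cancel hw0 hwt]
    gcongr
  have havg : volume B * translationEnergy p u z
      ≤ 2 ^ (p - 1) * (2 * (‖z‖ₑ ^ ((d : ℝ) + a) * I)) := by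
    calc volume B * translationEnergy p u z
        = ∫⁻ _ in B, translationEnergy p u z := by rw [setLIntegral_const, mul_comm]
      _ ≤ ∫⁻ w in B, 2 ^ (p - 1) * (translationEnergy p u (z - w) + translationEnergy p u w) :=
          lintegral_mono fun w => by
            simpa using translationEnergy_add_le hp hu (z - w) w
      _ = 2 ^ (p - 1) * ((∫⁻ w in B, translationEnergy p u w)
            + ∫⁻ w in B, translationEnergy p u w) := by
          rw [lintegral_const_mul' _ _ hpc,
            lintegral_add_right' _ (aemeasurable_translationEnergy hu).restrict, hrefl]
      _ ≤ _ := by rw [← two_mul]; gcongr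
  have hc0 : ‖z‖ₑ ^ (d : ℝ) ≠ 0 := by
    simp [hz]
  have hct : ‖z‖ₑ ^ (d : ℝ) ≠ ∞ := ENNReal.rpow_ne_top_of_nonneg (by positivity) hzt
  have hfinal : ‖z‖ₑ ^ (d : ℝ) * (volume (ball (0 : E) 1) * translationEnergy p u z)
      ≤ ‖z‖ₑ ^ (d : ℝ) * (2 ^ (p - 1) * 2 * I * 2 ^ d * ‖z‖ₑ ^ a) := by
    calc _ = 2 ^ d * (volume B * translationEnergy p u z) := by
          rw [← mul_assoc, ← hvol]; ring
      _ ≤ 2 ^ d * (2 ^ (p - 1) * (2 * (‖z‖ₑ ^ ((d : ℝ) + a) * I))) := by gcongr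
      _ = _ := by rw [ENNReal.rpow_add _ _ hz0 hzt]; ring
  have h3 := (ENNReal.mul_le_mul_iff_right hc0 hct).1 hfinal
  calc translationEnergy p u z
      = (volume (ball (0 : E) 1))⁻¹ * (volume (ball (0 : E) 1) * translationEnergy p u z) := by
        rw [← mul_assoc, ENNReal.inv_mul_cancel hV0 hVt, one_mul]
    _ ≤ (volume (ball (0 : E) 1))⁻¹ * (2 ^ (p - 1) * 2 * I * 2 ^ d * ‖z‖ₑ ^ a) := by gcongr
    _ = _ := by ring

/-- Far translates decouple: this holds exactly for compactly supported functions and extends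
to `L^p` because both sides are `p`-th powers of quantities Lipschitz in the `L^p` norm. -/
lemma tendsto_translationEnergy_cobounded {p : ℝ} (hp : 1 ≤ p) {u : E → ℝ}
    (hu : MemLp u (ENNReal.ofReal p) volume) :
    Tendsto (translationEnergy p u) (cobounded E)
      (𝓝 (2 * eLpNorm u (ENNReal.ofReal p) volume ^ p)) := by
  have hp0 : 0 < p := by linarith
  set q := ENNReal.ofReal p with hq
  have hq1 : 1 ≤ q := by simpa [hq] using hp
  -- the limit is `‖c u‖ ^ p`, so that `p`-th roots can be taken throughout
  set c : ℝ≥0∞ := 2 ^ p⁻¹ with hc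
  have hcp : c ^ p = 2 := by rw [hc, ENNReal.rpow_inv_rpow hp0.ne']
  have hc2 : c ≤ 2 := by
    calc c ≤ 2 ^ (1 : ℝ) := ENNReal.rpow_le_rpow_of_exponent_le (by norm_num)
            (inv_le_one_of_one_le₀ hp)
      _ = 2 := ENNReal.rpow_one _
  have hctop : c ≠ ∞ := ne_top_of_le_ne_top (by simp) hc2
  suffices h : Tendsto (fun z => eLpNorm (fun x => u (x + z) - u x) q volume) (cobounded E)
      (𝓝 (c * eLpNorm u q volume)) by
    have h' := (ENNReal.continuous_rpow_const (y := p)).continuousAt.tendsto.comp h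
    rw [ENNReal.mul_rpow_of_nonneg _ _ hp0.le, hcp] at h'
    refine h'.congr fun z => ?_
    rw [translationEnergy_eq_eLpNorm hp]
    rfl
  have hfin : c * eLpNorm u q volume ≠ ∞ := ENNReal.mul_ne_top hctop hu.2.ne
  rw [ENNReal.tendsto_nhds hfin]
  intro ε hε
  have hη : ε / 4 ≠ 0 := by simp [hε.ne']
  obtain ⟨v, hvs, hvu, -, hv⟩ :=
    hu.exists_hasCompactSupport_eLpNorm_sub_le (by simp [hq]) hη
  obtain ⟨r, hr⟩ := hvs.isCompact.isBounded.subset_ball (0 : E)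
  have hsupp : ∀ x, r ≤ ‖x‖ → v x = 0 := fun x hx => by
    by_contra h
    have := hr (subset_tsupport v h)
    rw [mem_ball_zero_iff] at this
    linarith
  have hvu' : eLpNorm (v - u) q volume ≤ ε / 4 := by rwa [eLpNorm_sub_comm]
  filter_upwards [(tendsto_norm_cobounded_atTop (E := E)).eventually_ge_atTop (2 * r)] with z hz
  have hvz : eLpNorm (fun x => v (x + z) - v x) q volume = c * eLpNorm v q volume := by
    have h1 := translationEnergy_eq_of_disjoint hp hv.1 hsupp hz
    rw [translationEnergy_eq_eLpNorm hp, ← hq, ← hcp, ← ENNReal.mul_rpow_of_nonneg _ _ hp0.le] at h1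
    exact (ENNReal.rpow_left_injective hp0.ne') h1
  have hdist : ∀ f g : E → ℝ, MemLp f q volume → MemLp g q volume →
      eLpNorm (fun x => f (x + z) - f x) q volume
        ≤ eLpNorm (fun x => g (x + z) - g x) q volume + 2 * eLpNorm (f - g) q volume := by
    intro f g hf hg
    have hfg := hf.1.sub hg.1
    have hfgz := aestronglyMeasurable_comp_add_right hfg z
    have hgz := aestronglyMeasurable_comp_add_right hg.1 z
    have heq : (fun x => f (x + z) - f x)
        = (fun x => g (x + z) - g x) + ((fun x => (f - g) (x + z)) - (f - g)) := by
      funext x; simp; ring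
    rw [heq]
    refine (eLpNorm_add_le (hgz.sub hg.1) (hfgz.sub hfg) hq1).trans ?_
    refine add_le_add le_rfl ?_
    refine (eLpNorm_sub_le hfgz hfg hq1).trans ?_
    rw [eLpNorm_comp_add_right hfg, two_mul]
  have hnorm : ∀ f g : E → ℝ, MemLp f q volume → MemLp g q volume →
      eLpNorm f q volume ≤ eLpNorm g q volume + eLpNorm (f - g) q volume := by
    intro f g hf hg
    calc eLpNorm f q volume = eLpNorm (g + (f - g)) q volume := by rw [add_sub_cancel]
      _ ≤ _ := eLpNorm_add_le hg.1 (hf.1.sub hg.1) hq1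
  have h4 : 2 * (ε / 4) + 2 * (ε / 4) = ε := by
    rw [← add_mul]
    norm_num
    exact ENNReal.mul_div_cancel (by norm_num) (by norm_num)
  constructor
  · rw [tsub_le_iff_right]
    calc c * eLpNorm u q volume
        ≤ c * (eLpNorm v q volume + ε / 4) := by
          gcongr; exact (hnorm u v hu hv).trans (by gcongr)
      _ = eLpNorm (fun x => v (x + z) - v x) q volume + c * (ε / 4) := by rw [mul_add, hvz]
      _ ≤ (eLpNorm (fun x => u (x + z) - u x) q volume + 2 * (ε / 4)) + 2 * (ε / 4) := by
          gcongr; exact (hdist v u hv hu).trans (by gcongr)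
      _ = _ := by rw [add_assoc, h4]
  · calc eLpNorm (fun x => u (x + z) - u x) q volume
        ≤ eLpNorm (fun x => v (x + z) - v x) q volume + 2 * (ε / 4) :=
          (hdist u v hu hv).trans (by gcongr)
      _ = c * eLpNorm v q volume + 2 * (ε / 4) := by rw [hvz]
      _ ≤ c * (eLpNorm u q volume + ε / 4) + 2 * (ε / 4) := by
          gcongr; exact (hnorm v u hv hu).trans (by gcongr)
      _ ≤ c * eLpNorm u q volume + 2 * (ε / 4) + 2 * (ε / 4) := by
          rw [mul_add]; gcongr
      _ = _ := by rw [add_assoc, h4]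

end Translations

/-! ### Hat functions as test functions -/

section TestFunction

/-- The hat function of height and radius `r`, a test function supported in the ball of
radius `r`. -/
def hat {E : Type*} [NormedAddCommGroup E] (r : ℝ) (x : E) : ℝ := max 0 (r - ‖x‖)

variable {E : Type*} [NormedAddCommGroup E]

lemma continuous_hat (r : ℝ) : Continuous (hat r : E → ℝ) := by
  unfold hat; fun_prop

lemma hat_eq_zero {r : ℝ} {x : E} (hx : r ≤ ‖x‖) : hat r x = 0 :=
  max_eq_left (by linarith)

lemma abs_hat_sub_le_norm (r : ℝ) (x z : E) : |hat r (x + z) - hat r x| ≤ ‖z‖ := by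
  refine (abs_max_sub_max_le_max 0 _ 0 _).trans (max_le (by simp) ?_)
  rw [sub_sub_sub_cancel_left]
  simpa using abs_norm_sub_norm_le x (x + z)

lemma abs_hat_sub_le {r : ℝ} (hr : 0 ≤ r) (x y : E) : |hat r y - hat r x| ≤ r := by
  have h : ∀ w : E, 0 ≤ hat r w ∧ hat r w ≤ r := fun w =>
    ⟨le_max_left _ _, max_le hr (by linarith [norm_nonneg w])⟩
  rw [abs_le]
  constructor <;> linarith [(h x).1, (h x).2, (h y).1, (h y).2]

lemma enorm_rpow_eq_ofReal {z : E} (hz : z ≠ 0) (a : ℝ) :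
    ‖z‖ₑ ^ a = ENNReal.ofReal (‖z‖ ^ a) := by
  rw [← ofReal_norm, ENNReal.ofReal_rpow_of_pos (norm_pos_iff.2 hz)]

variable [MeasureSpace E] [BorelSpace E] [(volume : Measure E).IsAddHaarMeasure]

lemma eLpNorm_hat_ne_zero {r : ℝ} (hr : 0 < r) {q : ℝ≥0∞} (hq : q ≠ 0) :
    eLpNorm (hat r : E → ℝ) q volume ≠ 0 := by
  rw [Ne, eLpNorm_eq_zero_iff (continuous_hat r).aestronglyMeasurable hq]
  intro h
  have h0 := (continuous_hat (E := E) r).ae_eq_iff_eq volume continuous_zero |>.1 h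
  have := congrFun h0 (0 : E)
  simp [hat] at this
  linarith

/-- The increments of the hat function over a shift `z` live on two balls and are bounded by any
common bound for the pointwise increments. -/
lemma translationEnergy_hat_le {p r : ℝ} (hp : 0 < p) {z : E} {b : ℝ≥0∞}
    (hb : ∀ x : E, ‖hat r (x + z) - hat r x‖ₑ ≤ b) :
    translationEnergy p (hat r) z ≤ 2 * volume (ball (0 : E) r) * b ^ p := by
  have hvol : volume ((fun x => x + z) ⁻¹' ball (0 : E) r) = volume (ball (0 : E) r) :=
    measure_preimage_add_right volume z _
  set A := ((fun x => x + z) ⁻¹' ball (0 : E) r) ∪ ball (0 : E) r with hA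
  have hAm : MeasurableSet A :=
    ((measurable_add_const z) measurableSet_ball).union measurableSet_ball
  calc translationEnergy p (hat r) z
      ≤ ∫⁻ x, A.indicator (fun _ => b ^ p) x := by
        refine lintegral_mono fun x => ?_
        by_cases hx : x ∈ A
        · simpa [hx] using ENNReal.rpow_le_rpow (hb x) hp.le
        · simp only [hA, Set.mem_union, Set.mem_preimage, mem_ball_zero_iff, not_or, not_lt] at hx
          simp [hat_eq_zero hx.1, hat_eq_zero hx.2, ENNReal.zero_rpow_of_pos hp]
    _ = b ^ p * volume A := by rw [lintegral_indicator hAm, setLIntegral_const]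
    _ ≤ b ^ p * (volume (ball (0 : E) r) + volume (ball (0 : E) r)) := by
        gcongr
        exact (measure_union_le _ _).trans_eq (by rw [hvol])
    _ = _ := by ring

variable [NormedSpace ℝ E] [FiniteDimensional ℝ E]

lemma memLp_hat (r : ℝ) (q : ℝ≥0∞) : MemLp (hat r : E → ℝ) q volume := by
  refine (continuous_hat r).memLp_of_hasCompactSupport ?_
  refine HasCompactSupport.intro (isCompact_closedBall (0 : E) r) fun x hx => hat_eq_zero ?_
  simp only [mem_closedBall, dist_zero_right, not_le] at hx
  exact hx.le

/-- Hat functions belong to every fractional Sobolev space: near the origin the Lipschitz bound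
gives the integrable singularity `|z| ^ (p - a - d)`, at infinity boundedness gives the
integrable decay `|z| ^ (-d - a)`. -/
lemma lintegral_translationEnergy_hat_ne_top [Nontrivial E] {p a r : ℝ} (ha : 0 < a)
    (hap : a < p) (hr : 0 ≤ r) :
    ∫⁻ z : E, (‖z‖ₑ ^ ((finrank ℝ E : ℝ) + a))⁻¹ * translationEnergy p (hat r) z ≠ ∞ := by
  set d := finrank ℝ E with hd
  have hd1 : 1 ≤ d := finrank_pos
  have hp : 0 < p := ha.trans hap
  set K : ℝ≥0∞ := 2 * volume (ball (0 : E) r) with hK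
  have hKt : K ≠ ∞ := ENNReal.mul_ne_top (by simp) measure_ball_lt_top.ne
  have hnear : ∫⁻ z in ball (0 : E) 1,
      (‖z‖ₑ ^ ((d : ℝ) + a))⁻¹ * translationEnergy p (hat r) z ≠ ∞ := by
    have hint : IntegrableOn (fun z : E => ‖z‖ ^ (-((d : ℝ) + a - p))) (ball 0 1) volume := by
      refine integrableOn_ball_of_norm_le_rpow hd1 (C := 1) (α := (d : ℝ) + a - p)
        (by linarith) (.of_forall fun z => ?_)
        (measurable_norm.pow_const _).aestronglyMeasurable
      rw [one_mul, Real.norm_of_nonneg (by positivity)]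
    have hfin : ∫⁻ z in ball (0 : E) 1, K * ENNReal.ofReal (‖z‖ ^ (-((d : ℝ) + a - p))) ≠ ∞ := by
      rw [lintegral_const_mul' _ _ hKt]
      refine ENNReal.mul_ne_top hKt (ne_of_lt ?_)
      have := hint.hasFiniteIntegral
      rwa [hasFiniteIntegral_iff_ofReal (.of_forall fun z => by positivity)] at this
    refine ne_top_of_le_ne_top hfin (lintegral_mono_ae (ae_restrict_of_ae ?_))
    filter_upwards [Measure.ae_ne volume (0 : E)] with z hz
    have h1 := translationEnergy_hat_le (r := r) hp (z := z) (b := ‖z‖ₑ) fun x => by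
      rw [enorm_le_iff_norm_le]; exact abs_hat_sub_le_norm r x z
    calc (‖z‖ₑ ^ ((d : ℝ) + a))⁻¹ * translationEnergy p (hat r) z
        ≤ (‖z‖ₑ ^ ((d : ℝ) + a))⁻¹ * (K * ‖z‖ₑ ^ p) := by gcongr
      _ = K * (‖z‖ₑ ^ (-((d : ℝ) + a)) * ‖z‖ₑ ^ p) := by rw [ENNReal.rpow_neg]; ring
      _ = _ := by
        rw [← ENNReal.rpow_add _ _ (by simpa using hz) (by simp), enorm_rpow_eq_ofReal hz]
        congr 3
        ring
  have hfar : ∫⁻ z in (ball (0 : E) 1)ᶜ,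
      (‖z‖ₑ ^ ((d : ℝ) + a))⁻¹ * translationEnergy p (hat r) z ≠ ∞ := by
    set c : ℝ := 2 ^ ((d : ℝ) + a) with hc
    have hfin : ∫⁻ z : E, ENNReal.ofReal c * (K * ENNReal.ofReal r ^ p)
        * ENNReal.ofReal ((1 + ‖z‖) ^ (-((d : ℝ) + a))) ≠ ∞ := by
      have hct : ENNReal.ofReal c * (K * ENNReal.ofReal r ^ p) ≠ ∞ := by finiteness
      rw [lintegral_const_mul' _ _ hct]
      exact ENNReal.mul_ne_top hct (finite_integral_one_add_norm (by linarith)).ne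
    refine ne_top_of_le_ne_top hfin ?_
    refine le_trans (setLIntegral_mono' measurableSet_ball.compl fun z hz => ?_)
      (setLIntegral_le_lintegral _ _)
    have hz1 : 1 ≤ ‖z‖ := by simpa using hz
    have hz0 : z ≠ 0 := norm_pos_iff.1 (by linarith)
    have h1 := translationEnergy_hat_le (r := r) hp (z := z) (b := ENNReal.ofReal r) fun x => by
      rw [← ofReal_norm]; exact ENNReal.ofReal_le_ofReal (abs_hat_sub_le hr x (x + z))
    have h2 : (‖z‖ₑ ^ ((d : ℝ) + a))⁻¹
        ≤ ENNReal.ofReal c * ENNReal.ofReal ((1 + ‖z‖) ^ (-((d : ℝ) + a))) := by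
      rw [← ENNReal.rpow_neg, enorm_rpow_eq_ofReal hz0, ← ENNReal.ofReal_mul (by positivity)]
      refine ENNReal.ofReal_le_ofReal ?_
      rw [Real.rpow_neg (by positivity), Real.rpow_neg (by positivity), ← div_eq_mul_inv,
        inv_le_iff_one_le_mul₀ (by positivity), div_mul_eq_mul_div, one_le_div (by positivity),
        hc, ← Real.mul_rpow (by norm_num) (by positivity)]
      exact Real.rpow_le_rpow (by positivity) (by linarith) (by positivity)
    calc _ ≤ (ENNReal.ofReal c * ENNReal.ofReal ((1 + ‖z‖) ^ (-((d : ℝ) + a))))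
          * (K * ENNReal.ofReal r ^ p) := mul_le_mul' h2 h1
      _ = _ := by ring
  rw [← lintegral_add_compl _ (measurableSet_ball (x := (0 : E)) (ε := 1))]
  exact ENNReal.add_ne_top.2 ⟨hnear, hfar⟩

end TestFunction

variable {N : ℕ}

/-! ### Energies as integrals over displacements -/

section Displacement

lemma energy_eq_lintegral {p : ℝ} {ρ : EuclideanSpace ℝ (Fin N) → ℝ≥0}
    (hρ : AEMeasurable ρ volume) {u : EuclideanSpace ℝ (Fin N) → ℝ}
    (hu : AEStronglyMeasurable u volume) :
    energy p ρ u = ∫⁻ z, (ρ z : ℝ≥0∞) * translationEnergy p u z :=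
  lintegral_displacement hu hρ.coe_nnreal_ennreal

lemma gagliardo_eq_lintegral {s p : ℝ} {u : EuclideanSpace ℝ (Fin N) → ℝ}
    (hu : AEStronglyMeasurable u volume) :
    gagliardo s p u = ∫⁻ z : EuclideanSpace ℝ (Fin N),
      (‖z‖ₑ ^ ((N : ℝ) + s * p))⁻¹ * translationEnergy p u z := by
  have hw : AEMeasurable (fun z : EuclideanSpace ℝ (Fin N) => (‖z‖ₑ ^ ((N : ℝ) + s * p))⁻¹)
      volume := by fun_prop
  rw [← lintegral_displacement hu hw]
  refine lintegral_congr fun q => ?_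
  rw [div_eq_mul_inv, mul_comm, enorm_sub_rev q.1 q.2]

lemma shortRange_eq_lintegral (p : ℝ) (ρ : EuclideanSpace ℝ (Fin N) → ℝ≥0) (R : ℝ)
    (u : EuclideanSpace ℝ (Fin N) → ℝ) :
    shortRange p ρ R u
      = ∫⁻ z in {z : EuclideanSpace ℝ (Fin N) | ‖z‖ < R},
          (ρ z : ℝ≥0∞) * translationEnergy p u z :=
  lintegral_congr fun _ => lintegral_const_mul' _ _ ENNReal.coe_ne_top

lemma measurableSet_norm_lt (R : ℝ) :
    MeasurableSet {z : EuclideanSpace ℝ (Fin N) | ‖z‖ < R} :=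
  measurableSet_lt measurable_norm measurable_const

lemma measurableSet_le_norm (R : ℝ) :
    MeasurableSet {z : EuclideanSpace ℝ (Fin N) | R ≤ ‖z‖} :=
  measurableSet_le measurable_const measurable_norm

lemma lintegral_norm_lt_add_le_norm (f : EuclideanSpace ℝ (Fin N) → ℝ≥0∞) (R : ℝ) :
    (∫⁻ z in {z | ‖z‖ < R}, f z) + ∫⁻ z in {z | R ≤ ‖z‖}, f z = ∫⁻ z, f z := by
  rw [← lintegral_add_compl (μ := volume) f (measurableSet_norm_lt R)]
  have hc : {z : EuclideanSpace ℝ (Fin N) | ‖z‖ < R}ᶜ = {z | R ≤ ‖z‖} := by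
    ext z
    simp
  rw [hc]

lemma energy_eq_shortRange_add {p : ℝ} {ρ : EuclideanSpace ℝ (Fin N) → ℝ≥0}
    (hρ : AEMeasurable ρ volume) {u : EuclideanSpace ℝ (Fin N) → ℝ}
    (hu : AEStronglyMeasurable u volume) (R : ℝ) :
    energy p ρ u = shortRange p ρ R u
      + ∫⁻ z in {z | R ≤ ‖z‖}, (ρ z : ℝ≥0∞) * translationEnergy p u z := by
  rw [energy_eq_lintegral hρ hu, shortRange_eq_lintegral, lintegral_norm_lt_add_le_norm]

end Displacement

/-! ### Tail masses and inner moments of normalized kernels -/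

section Moments

/-- The mass of a kernel outside the open ball of radius `R`; unlike `tailMass` it includes the
sphere, so it complements `innerMoment` exactly. -/
noncomputable def closedTailMass (ρ : EuclideanSpace ℝ (Fin N) → ℝ≥0) (R : ℝ) : ℝ≥0∞ :=
  ∫⁻ z in {z : EuclideanSpace ℝ (Fin N) | R ≤ ‖z‖}, (ρ z : ℝ≥0∞)

/-- The quantity normalized in the admissible class, `∫ min (1, |z| ^ a) ρ dz`. -/
noncomputable def totalMass (a : ℝ) (ρ : EuclideanSpace ℝ (Fin N) → ℝ≥0) : ℝ≥0∞ :=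
  ∫⁻ z : EuclideanSpace ℝ (Fin N), min 1 (‖z‖ₑ ^ a) * (ρ z : ℝ≥0∞)

lemma tailMass_le_closedTailMass (ρ : EuclideanSpace ℝ (Fin N) → ℝ≥0) (R : ℝ) :
    tailMass ρ R ≤ closedTailMass ρ R :=
  lintegral_mono_set fun z (hz : R < ‖z‖) => hz.le

lemma closedTailMass_le_tailMass (ρ : EuclideanSpace ℝ (Fin N) → ℝ≥0) {R R' : ℝ} (h : R < R') :
    closedTailMass ρ R' ≤ tailMass ρ R :=
  lintegral_mono_set fun _ hz => lt_of_lt_of_le h hz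

lemma innerMoment_mono (s p : ℝ) (ρ : EuclideanSpace ℝ (Fin N) → ℝ≥0) {R R' : ℝ}
    (h : R ≤ R') : innerMoment s p ρ R ≤ innerMoment s p ρ R' :=
  lintegral_mono_set fun _ hz => lt_of_lt_of_le hz h

lemma totalMass_eq {s p : ℝ} (ha : 0 < s * p) (ρ : EuclideanSpace ℝ (Fin N) → ℝ≥0) :
    totalMass (s * p) ρ = innerMoment s p ρ 1 + closedTailMass ρ 1 := by
  rw [totalMass, ← lintegral_norm_lt_add_le_norm _ 1]
  congr 1
  · refine setLIntegral_congr_fun (measurableSet_norm_lt 1) fun z hz => ?_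
    have hz' : ‖z‖ₑ ≤ 1 := by
      rw [← ofReal_norm, ENNReal.ofReal_le_one]; exact le_of_lt hz
    rw [min_eq_right (ENNReal.rpow_le_one hz' ha.le)]
  · refine setLIntegral_congr_fun (measurableSet_le_norm 1) fun z hz => ?_
    have hz' : 1 ≤ ‖z‖ₑ := by
      rw [← ofReal_norm, ENNReal.one_le_ofReal]; exact hz
    rw [min_eq_left (ENNReal.one_le_rpow hz' ha), one_mul]

lemma totalMass_le (s p : ℝ) (ρ : EuclideanSpace ℝ (Fin N) → ℝ≥0) (R : ℝ) :
    totalMass (s * p) ρ ≤ innerMoment s p ρ R + closedTailMass ρ R := by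
  rw [totalMass, ← lintegral_norm_lt_add_le_norm _ R]
  gcongr
  · exact lintegral_mono fun z => by gcongr; exact min_le_right _ _
  · exact lintegral_mono fun z => mul_le_of_le_one_left zero_le (min_le_left _ _)

lemma tailMass_le {s p : ℝ} (ha : 0 < s * p) (ρ : EuclideanSpace ℝ (Fin N) → ℝ≥0) {R : ℝ}
    (hR : 0 < R) :
    tailMass ρ R
      ≤ (ENNReal.ofReal R ^ (s * p))⁻¹ * innerMoment s p ρ 1 + totalMass (s * p) ρ := by
  have hRt : (ENNReal.ofReal R ^ (s * p))⁻¹ ≠ ∞ := by simp [hR]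
  have h1 : closedTailMass ρ 1 ≤ totalMass (s * p) ρ := by
    rw [totalMass_eq ha]; exact le_add_self
  refine le_trans ?_ (add_le_add le_rfl h1)
  rw [tailMass, innerMoment, closedTailMass, ← lintegral_const_mul' _ _ hRt]
  refine le_trans (lintegral_mono_set (t := {z | ‖z‖ < 1 ∧ R < ‖z‖} ∪ {z | 1 ≤ ‖z‖}) ?_)
    ((lintegral_union_le _ _ _).trans (add_le_add ?_ le_rfl))
  · intro z hz
    exact (lt_or_ge ‖z‖ 1).imp (fun h => ⟨h, hz⟩) id
  · refine le_trans ?_ (lintegral_mono_set (s := {z | ‖z‖ < 1 ∧ R < ‖z‖}) fun z hz => hz.1)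
    refine setLIntegral_mono' ((measurableSet_norm_lt 1).inter
      (measurableSet_lt measurable_const measurable_norm)) fun z hz => ?_
    rw [← mul_assoc]
    refine le_mul_of_one_le_left zero_le ?_
    rw [← ENNReal.inv_mul_cancel (a := ENNReal.ofReal R ^ (s * p)) (by simp [hR])
      (by simp [ha.le])]
    gcongr
    rw [← ofReal_norm]
    exact ENNReal.ofReal_le_ofReal hz.2.le

lemma innerMoment_le {s p : ℝ} (ha : 0 < s * p) (ρ : EuclideanSpace ℝ (Fin N) → ℝ≥0) {R : ℝ}
    (hR : 1 ≤ R) (hfin : closedTailMass ρ R ≠ ∞) :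
    innerMoment s p ρ R ≤ innerMoment s p ρ 1
      + ENNReal.ofReal R ^ (s * p) * (closedTailMass ρ 1 - closedTailMass ρ R) := by
  set A : Set (EuclideanSpace ℝ (Fin N)) := {z | 1 ≤ ‖z‖ ∧ ‖z‖ < R} with hA
  have hAm : MeasurableSet A := (measurableSet_le_norm 1).inter (measurableSet_norm_lt R)
  have hann : ∫⁻ z in A, (ρ z : ℝ≥0∞) ≤ closedTailMass ρ 1 - closedTailMass ρ R := by
    refine ENNReal.le_sub_of_add_le_right hfin ?_
    rw [closedTailMass, ← lintegral_union (measurableSet_le_norm R)]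
    · refine lintegral_mono_set fun z hz => hz.elim (fun h => h.1) fun h => hR.trans h
    · exact Set.disjoint_left.2 fun z h1 h2 => absurd h1.2 (not_lt.2 h2)
  have hRt : ENNReal.ofReal R ^ (s * p) ≠ ∞ := by simp [ha.le]
  calc innerMoment s p ρ R
      ≤ innerMoment s p ρ 1 + ∫⁻ z in A, ‖z‖ₑ ^ (s * p) * (ρ z : ℝ≥0∞) := by
        refine le_trans (lintegral_mono_set ?_) (lintegral_union_le _ _ _)
        intro z hz
        exact (lt_or_ge ‖z‖ 1).imp id fun h => ⟨h, hz⟩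
    _ ≤ innerMoment s p ρ 1 + ∫⁻ z in A, ENNReal.ofReal R ^ (s * p) * (ρ z : ℝ≥0∞) := by
        gcongr 1
        refine setLIntegral_mono' hAm fun z hz => ?_
        gcongr
        rw [← ofReal_norm]
        exact ENNReal.ofReal_le_ofReal hz.2.le
    _ ≤ _ := by
        rw [lintegral_const_mul' _ _ hRt]
        gcongr

variable {ι : Type*} {l : Filter ι} {ρ : ι → EuclideanSpace ℝ (Fin N) → ℝ≥0}

/-- For normalized kernels, attenuation of the short range forces the mass to escape. -/
lemma tendsto_tailMass_of_innerMoment {s p : ℝ} (ha : 0 < s * p)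
    (htot : Tendsto (fun i => totalMass (s * p) (ρ i)) l (𝓝 1))
    (hinner : ∀ R, 0 < R → Tendsto (fun i => innerMoment s p (ρ i) R) l (𝓝 0)) {R : ℝ}
    (hR : 0 < R) : Tendsto (fun i => tailMass (ρ i) R) l (𝓝 1) := by
  have hlow : Tendsto (fun i => totalMass (s * p) (ρ i) - innerMoment s p (ρ i) (R + 1)) l
      (𝓝 1) := by
    simpa using ENNReal.Tendsto.sub htot (hinner (R + 1) (by linarith)) (Or.inl (by simp))
  have hup : Tendsto (fun i => (ENNReal.ofReal R ^ (s * p))⁻¹ * innerMoment s p (ρ i) 1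
      + totalMass (s * p) (ρ i)) l (𝓝 1) := by
    have := (ENNReal.Tendsto.const_mul (a := (ENNReal.ofReal R ^ (s * p))⁻¹)
      (hinner 1 one_pos) (Or.inr (by simp [hR]))).add htot
    simpa using this
  refine tendsto_of_tendsto_of_tendsto_of_le_of_le hlow hup (fun i => ?_)
    fun i => tailMass_le ha (ρ i) hR
  refine tsub_le_iff_left.2 ((totalMass_le s p (ρ i) (R + 1)).trans ?_)
  gcongr
  exact closedTailMass_le_tailMass _ (by linarith)

/-- For normalized kernels, escape of the mass forces attenuation of the short range. -/
lemma tendsto_innerMoment_of_closedTailMass {s p : ℝ} (ha : 0 < s * p)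
    (htot : Tendsto (fun i => totalMass (s * p) (ρ i)) l (𝓝 1))
    (htail : ∀ R, 0 < R → Tendsto (fun i => closedTailMass (ρ i) R) l (𝓝 1)) (R : ℝ) :
    Tendsto (fun i => innerMoment s p (ρ i) R) l (𝓝 0) := by
  have hfin : ∀ R, 0 < R → ∀ᶠ i in l, closedTailMass (ρ i) R ≠ ∞ := fun R hR =>
    (htail R hR).eventually_ne (by simp)
  have hone : Tendsto (fun i => innerMoment s p (ρ i) 1) l (𝓝 0) := by
    have h := ENNReal.Tendsto.sub htot (htail 1 one_pos) (Or.inl (by simp))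
    rw [tsub_self] at h
    refine h.congr' ?_
    filter_upwards [hfin 1 one_pos] with i hi
    rw [totalMass_eq ha, ENNReal.add_sub_cancel_right hi]
  set M := max R 1 with hM
  have hM1 : 1 ≤ M := le_max_right _ _
  have hMt : ENNReal.ofReal M ^ (s * p) ≠ ∞ := by simp [ha.le]
  have hup : Tendsto (fun i => innerMoment s p (ρ i) 1 + ENNReal.ofReal M ^ (s * p)
      * (closedTailMass (ρ i) 1 - closedTailMass (ρ i) M)) l (𝓝 0) := by
    have h := hone.add (ENNReal.Tendsto.const_mul (a := ENNReal.ofReal M ^ (s * p))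
      (ENNReal.Tendsto.sub (htail 1 one_pos) (htail M (by linarith)) (Or.inl (by simp)))
      (Or.inr hMt))
    simpa using h
  refine tendsto_of_tendsto_of_tendsto_of_le_of_le' tendsto_const_nhds hup
    (.of_forall fun _ => zero_le) ?_
  filter_upwards [hfin M (by linarith)] with i hi
  exact (innerMoment_mono s p (ρ i) (le_max_left R 1)).trans (innerMoment_le ha (ρ i) hM1 hi)

lemma tendsto_tailMass_of_closedTailMass
    (htail : ∀ R, 0 < R → Tendsto (fun i => closedTailMass (ρ i) R) l (𝓝 1)) {R : ℝ}
    (hR : 0 < R) : Tendsto (fun i => tailMass (ρ i) R) l (𝓝 1) :=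
  tendsto_of_tendsto_of_tendsto_of_le_of_le (htail (R + 1) (by linarith)) (htail R hR)
    (fun i => closedTailMass_le_tailMass (ρ i) (by linarith))
    fun i => tailMass_le_closedTailMass (ρ i) R

end Moments

/-! ### Equivalence of the conditions -/

section Equivalence

variable {s p : ℝ} {ρ : ℝ → EuclideanSpace ℝ (Fin N) → ℝ≥0}

lemma UniformMomentConditions.iteratedLimitConditions (h : UniformMomentConditions s p ρ) :
    IteratedLimitConditions s p ρ := by
  refine ⟨⟨fun _ => 1, ?_, tendsto_const_nhds⟩, ⟨fun _ => 0, ?_, tendsto_const_nhds⟩⟩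
  · filter_upwards [eventually_gt_atTop 0] with R hR using (h R hR).1
  · filter_upwards [eventually_gt_atTop 0] with R hR using (h R hR).2

/-- The inner moment increases with the radius, so its smallness at large radii gives smallness
at all radii. -/
lemma IteratedLimitConditions.uniformMomentConditions (ha : 0 < s * p)
    (hρ : Admissible s p ρ) (h : IteratedLimitConditions s p ρ) :
    UniformMomentConditions s p ρ := by
  obtain ⟨g, hg, hg0⟩ := h.2
  have hinner : ∀ R, 0 < R → Tendsto (fun ε => innerMoment s p (ρ ε) R) (𝓝[>] 0) (𝓝 0) := by
    intro R _
    refine tendsto_order.2 ⟨fun b hb => absurd hb not_lt_zero, fun b hb => ?_⟩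
    obtain ⟨R', hR', hgR', hlt⟩ :=
      ((eventually_ge_atTop R).and (hg.and (hg0.eventually_lt_const hb))).exists
    filter_upwards [hgR'.eventually_lt_const hlt] with ε hε
    exact (innerMoment_mono s p (ρ ε) hR').trans_lt hε
  exact fun R hR => ⟨tendsto_tailMass_of_innerMoment ha hρ.normalized hinner hR, hinner R hR⟩

lemma tendsto_shortRange (hN : 1 ≤ N) (hp : 1 ≤ p) (ha : 0 < s * p)
    (h : UniformMomentConditions s p ρ) {u : EuclideanSpace ℝ (Fin N) → ℝ}
    (hu : MemFracSobolev s p u) {R : ℝ} (hR : 0 < R) :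
    Tendsto (fun ε => shortRange p (ρ ε) R u) (𝓝[>] 0) (𝓝 0) := by
  have : Nontrivial (EuclideanSpace ℝ (Fin N)) :=
    nontrivial_of_finrank_pos (R := ℝ) (by rw [finrank_euclideanSpace_fin]; lia)
  have hfin := hu.2.ne
  rw [gagliardo_eq_lintegral hu.1.1] at hfin
  obtain ⟨C, hC, hbound⟩ :=
    translationEnergy_le_mul_enorm_rpow hp ha hu.1.1 (by simpa using hfin)
  have hup := ENNReal.Tendsto.const_mul (a := C) (h R hR).2 (Or.inr hC)
  rw [mul_zero] at hup
  refine tendsto_of_tendsto_of_tendsto_of_le_of_le tendsto_const_nhds hup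
    (fun _ => zero_le) fun ε => ?_
  simp only [shortRange_eq_lintegral, innerMoment]
  rw [← lintegral_const_mul' _ _ hC]
  refine lintegral_mono fun z => ?_
  calc (ρ ε z : ℝ≥0∞) * translationEnergy p u z
      ≤ (ρ ε z : ℝ≥0∞) * (C * ‖z‖ₑ ^ (s * p)) := by gcongr; exact hbound z
    _ = _ := by ring

lemma UniformMomentConditions.formulaOnFracSobolev (hN : 1 ≤ N) (hp : 1 ≤ p) (ha : 0 < s * p)
    (hρ : Admissible s p ρ) (h : UniformMomentConditions s p ρ) :
    FormulaOnFracSobolev s p ρ := by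
  intro u hu
  have hp0 : 0 < p := by linarith
  have hshort := fun R hR => tendsto_shortRange hN hp ha h hu (R := R) hR
  set L := 2 * eLpNorm u (ENNReal.ofReal p) volume ^ p with hL
  have hLt : L ≠ ∞ :=
    ENNReal.mul_ne_top (by simp) (ENNReal.rpow_ne_top_of_nonneg hp0.le hu.1.2.ne)
  have hpos : ∀ᶠ ε : ℝ in 𝓝[>] 0, 0 < ε := eventually_mem_nhdsWithin
  -- a property open at the limit `L` holds for the translation energy at all large displacements
  have hfar : ∀ P : ℝ≥0∞ → Prop, (∀ᶠ y in 𝓝 L, P y) →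
      ∃ R : ℝ, 0 < R ∧ ∀ z : EuclideanSpace ℝ (Fin N), R ≤ ‖z‖ → P (translationEnergy p u z) := by
    intro P hP
    obtain ⟨R, -, hR⟩ := hasBasis_cobounded_norm.eventually_iff.1
      ((tendsto_translationEnergy_cobounded hp hu.1).eventually hP)
    exact ⟨max R 1, by positivity, fun z hz => hR ((le_max_left R 1).trans hz)⟩
  have hlim : Tendsto (fun ε => energy p (ρ ε) u) (𝓝[>] 0) (𝓝 L) := by
    refine tendsto_order.2 ⟨fun a haL => ?_, fun b hLb => ?_⟩
    · obtain ⟨a', haa', ha'L⟩ := exists_between haL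
      obtain ⟨R, hR, hRz⟩ := hfar _ (eventually_gt_nhds ha'L)
      have hmul := ENNReal.Tendsto.const_mul (a := a') (h R hR).1 (Or.inl (by simp))
      rw [mul_one] at hmul
      filter_upwards [hpos, hmul.eventually_const_lt haa'] with ε hε hlt
      refine hlt.trans_le ?_
      rw [energy_eq_shortRange_add (hρ.aemeasurable ε hε) hu.1.1 R, tailMass,
        ← lintegral_const_mul' _ _ (ne_top_of_lt ha'L)]
      refine le_trans (le_trans (lintegral_mono_set (t := {z | R ≤ ‖z‖}) fun z (hz : R < ‖z‖) => hz.le)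
        ?_) le_add_self
      refine setLIntegral_mono' (measurableSet_le_norm R) fun z hz => ?_
      rw [mul_comm]
      gcongr
      exact (hRz z hz).le
    · obtain ⟨b', hLb', hb'b⟩ := exists_between hLb
      obtain ⟨R, hR, hRz⟩ := hfar _ (eventually_lt_nhds hLb')
      -- the open tail over `R` contains the complement of the open ball of radius `R + 1`
      have hmul := (hshort (R + 1) (by linarith)).add
        (ENNReal.Tendsto.const_mul (a := b') (h R hR).1 (Or.inl (by simp)))
      rw [mul_one, zero_add] at hmul
      filter_upwards [hpos, hmul.eventually_lt_const hb'b] with ε hε hlt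
      refine lt_of_le_of_lt ?_ hlt
      rw [energy_eq_shortRange_add (hρ.aemeasurable ε hε) hu.1.1 (R + 1)]
      refine add_le_add le_rfl ?_
      refine le_trans ?_ (mul_le_mul_right (closedTailMass_le_tailMass (ρ ε) (lt_add_one R)) b')
      rw [closedTailMass, ← lintegral_const_mul' _ _ (ne_top_of_lt hb'b)]
      refine setLIntegral_mono' (measurableSet_le_norm (R + 1)) fun z hz => ?_
      rw [mul_comm]
      gcongr
      exact (hRz z ((lt_add_one R).le.trans hz)).le
  refine ⟨?_, hlim, hshort⟩
  obtain ⟨δ, hδ, hsub⟩ := mem_nhdsGT_iff_exists_Ioc_subset.1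
    (hlim.eventually_lt_const hLt.lt_top)
  exact ⟨δ, hδ, fun ε h0 h1 => ⟨hu.1, hsub ⟨h0, h1⟩⟩⟩

lemma memFracSobolev_hat (hN : 1 ≤ N) (hp : 1 ≤ p) (ha : 0 < s * p) (hs1 : s < 1) {r : ℝ}
    (hr : 0 ≤ r) : MemFracSobolev s p (hat r : EuclideanSpace ℝ (Fin N) → ℝ) := by
  have : Nontrivial (EuclideanSpace ℝ (Fin N)) :=
    nontrivial_of_finrank_pos (R := ℝ) (by rw [finrank_euclideanSpace_fin]; lia)
  refine ⟨memLp_hat r _, ?_⟩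
  rw [gagliardo_eq_lintegral (continuous_hat r).aestronglyMeasurable]
  have := lintegral_translationEnergy_hat_ne_top (E := EuclideanSpace ℝ (Fin N)) (p := p) ha
    (by nlinarith) hr
  simpa [lt_top_iff_ne_top] using this

/-- Testing the formula on a hat function of radius `R / 2`, whose translation energy is exactly
`2 ‖u‖ ^ p` at all displacements of length at least `R`, gives escape of the mass. -/
lemma FormulaOnFracSobolev.tendsto_closedTailMass (hN : 1 ≤ N) (hp : 1 ≤ p) (ha : 0 < s * p)
    (hs1 : s < 1) (hρ : Admissible s p ρ) (h : FormulaOnFracSobolev s p ρ) {R : ℝ}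
    (hR : 0 < R) : Tendsto (fun ε => closedTailMass (ρ ε) R) (𝓝[>] 0) (𝓝 1) := by
  have hp0 : 0 < p := by linarith
  set u : EuclideanSpace ℝ (Fin N) → ℝ := hat (R / 2) with hu
  have hum : AEStronglyMeasurable u volume := (continuous_hat _).aestronglyMeasurable
  obtain ⟨-, hlim, hshort⟩ := h u (memFracSobolev_hat hN hp ha hs1 (by positivity))
  set L := 2 * eLpNorm u (ENNReal.ofReal p) volume ^ p with hL
  have hLt : L ≠ ∞ :=
    ENNReal.mul_ne_top (by simp) (ENNReal.rpow_ne_top_of_nonneg hp0.le (memLp_hat _ _).2.ne)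
  have hL0 : L ≠ 0 := by
    have h0 : eLpNorm u (ENNReal.ofReal p) volume ≠ 0 :=
      eLpNorm_hat_ne_zero (by positivity) (by simpa using hp0)
    simp [hL, h0, hp0.le]
  have hsub := ENNReal.Tendsto.div_const (b := L)
    (ENNReal.Tendsto.sub hlim (hshort R hR) (Or.inl hLt)) (Or.inr hL0)
  rw [tsub_zero, ENNReal.div_self hL0 hLt] at hsub
  refine hsub.congr' ?_
  filter_upwards [eventually_mem_nhdsWithin, (hshort R hR).eventually_ne ENNReal.zero_ne_top]
    with ε hε hfin
  have hfar : ∫⁻ z in {z | R ≤ ‖z‖}, (ρ ε z : ℝ≥0∞) * translationEnergy p u z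
      = closedTailMass (ρ ε) R * L := by
    rw [closedTailMass, ← lintegral_mul_const' _ _ hLt]
    refine setLIntegral_congr_fun (measurableSet_le_norm R) fun z hz => ?_
    rw [translationEnergy_eq_of_disjoint hp hum (r := R / 2) (fun x hx => hat_eq_zero hx)
      (by rw [mul_div_cancel₀ _ two_ne_zero]; exact hz)]
  rw [energy_eq_shortRange_add (hρ.aemeasurable ε hε) hum R, hfar,
    ENNReal.add_sub_cancel_left hfin, ENNReal.mul_div_cancel_right hL0 hLt]

lemma FormulaOnFracSobolev.uniformMomentConditions (hN : 1 ≤ N) (hp : 1 ≤ p) (ha : 0 < s * p)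
    (hs1 : s < 1) (hρ : Admissible s p ρ) (h : FormulaOnFracSobolev s p ρ) :
    UniformMomentConditions s p ρ := by
  have htail := fun R (hR : 0 < R) => h.tendsto_closedTailMass hN hp ha hs1 hρ hR
  exact fun R hR => ⟨tendsto_tailMass_of_closedTailMass htail hR,
    tendsto_innerMoment_of_closedTailMass ha hρ.normalized htail R⟩

end Equivalence

end MazyaShaposhnikova

theorem theorem3 (N : ℕ) (hN : 1 ≤ N) (p s : ℝ) (hp : 1 ≤ p) (hs0 : 0 < s) (hs1 : s < 1)
    (ρ : ℝ → EuclideanSpace ℝ (Fin N) → ℝ≥0)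
    (hρ : MazyaShaposhnikova.Admissible s p ρ) :
    List.TFAE
      [MazyaShaposhnikova.UniformMomentConditions s p ρ,
       MazyaShaposhnikova.IteratedLimitConditions s p ρ,
       MazyaShaposhnikova.FormulaOnFracSobolev s p ρ] := by
  have ha : 0 < s * p := by positivity
  tfae_have 1 → 2 := fun h => h.iteratedLimitConditions
  tfae_have 2 → 1 := fun h => h.uniformMomentConditions ha hρ
  tfae_have 1 → 3 := fun h => h.formulaOnFracSobolev hN hp ha hρ
  tfae_have 3 → 1 := fun h => h.uniformMomentConditions hN hp ha hs1 hρ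
  tfae_finish
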